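/- We use continuous logic in the language of unital C$^*$-algebras. Atomic formulas are $\|p(\vec x)\|$ with $p$ a complex $*$-polynomial in noncommuting variables (with constant term). Connectives are continuous functions $\mathbb{R}^k\to\mathbb{R}$. The quantifiers are $\sup_{\|x\|\le R}$ and $\inf_{\|x\|\le R}$ with $R\in\mathbb{N}$. A theory $T$ is a set of sentences, and a unital C$^*$-algebra $A$ is a model of $T$ if $\varphi^A=0$ for all $\varphi\in T$. Embeddings are isometric unital $*$-homomorphisms. A theory $T^*$ is model-complete if every embedding between models of $T^*$ preserves the values of all formulas. It has quantifier elimination if for every formula $\varphi(\vec x)$, every $R\in\mathbb{N}$ and every $\varepsilon>0$ there is a quantifier-free formula $\psi(\vec x)$ such that $|\varphi^A(\vec a)-\psi^A(\vec a)|\le\varepsilon$ for every model $A$ of $T^*$ and every tuple $\vec a$ from the ball of radius $R$ of $A$. A model companion of a theory $T$ is a model-complete theory $T^*$ such that every model of $T$ embeds into a model of $T^*$ and every model of $T^*$ embeds into a model of $T$. A model completion of $T$ is a model companion of $T$ that has quantifier elimination. Let $T_{\operatorname{conn}}$ be the theory of connected abelian C$^*$-algebras, that is, the set of all sentences $\varphi$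 such that $\varphi^A=0$ for every abelian unital C$^*$-algebra $A$ whose Gelfand spectrum is connected (and nonempty). \textbf{Proposition.} $T_{\operatorname{conn}}$ does not have a model completion. Moreover, continua (nonempty connected compact Hausdorff spaces) do not have the co-amalgamation property: there are continuous surjections $f,g\colon[0,1]\to\mathbb{S}^1$ such that there are no continuum $W$ and continuous surjections $r,s\colon W\to[0,1]$ with $f\circ r=g\circ s$. -/

import Mathlib

universe u v

namespace CStarLogic

/-- Terms of the language of unital C⋆-algebras in the variables `x₀, …, xₙ₋₁`: complex
⋆-polynomials (with constant terms, and in noncommuting variables). -/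
inductive Term (n : ℕ) : Type
  | var (i : Fin n) : Term n
  | one : Term n
  | smul (c : ℂ) (t : Term n) : Term n
  | add (s t : Term n) : Term n
  | mul (s t : Term n) : Term n
  | star (t : Term n) : Term n

/-- Value of a term in a C⋆-algebra. -/
def Term.eval {A : Type u} [CStarAlgebra A] {n : ℕ} : Term n → (Fin n → A) → A
  | .var i, a => a i
  | .one, _ => 1
  | .smul c t, a => c • t.eval a
  | .add s t, a => s.eval a + t.eval a
  | .mul s t, a => s.eval a * t.eval a
  | .star t, a => Star.star (t.eval a)

/-- Formulas of continuous logic in the language of unital C⋆-algebras, with free variables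
`x₀, …, xₙ₋₁`. Atomic formulas are norms of terms (the metric is `‖s - t‖`), connectives are the
continuous functions `ℝᵏ → ℝ`, and the quantifiers are `sup` and `inf` over the domains of
quantification of the language, the closed balls of radius `R = 0, 1, 2, …`; the quantifier
binds the last variable. -/
inductive Formula : ℕ → Type
  | norm {n : ℕ} (t : Term n) : Formula n
  | conn {n k : ℕ} (g : C(Fin k → ℝ, ℝ)) (φ : Fin k → Formula n) : Formula n
  | sup {n : ℕ} (R : ℕ) (φ : Formula (n + 1)) : Formula n
  | inf {n : ℕ} (R : ℕ) (φ : Formula (n + 1)) : Formula n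

/-- Value of a formula in a C⋆-algebra. The suprema and infima are those of nonempty bounded
sets of reals, see `Formula.exists_abs_eval_le`. -/
noncomputable def Formula.eval {A : Type u} [CStarAlgebra A] :
    {n : ℕ} → Formula n → (Fin n → A) → ℝ
  | _, .norm t, a => ‖t.eval a‖
  | _, .conn g φ, a => g fun i => (φ i).eval a
  | _, .sup R φ, a =>
      ⨆ x : Metric.closedBall (0 : A) (R : ℝ), φ.eval (Fin.snoc (α := fun _ => A) a x.1)
  | _, .inf R φ, a =>
      ⨅ x : Metric.closedBall (0 : A) (R : ℝ), φ.eval (Fin.snoc (α := fun _ => A) a x.1)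

theorem Term.exists_norm_eval_le (A : Type u) [CStarAlgebra A] {n : ℕ} (t : Term n) (R : ℕ) :
    ∃ C : ℝ, 0 ≤ C ∧ ∀ a : Fin n → A, (∀ i, ‖a i‖ ≤ R) → ‖t.eval a‖ ≤ C := by
  induction t with
  | var i => exact ⟨R, by positivity, fun a h => h i⟩
  | one => exact ⟨‖(1 : A)‖, norm_nonneg _, fun a h => le_rfl⟩
  | smul c t ih =>
    obtain ⟨C, h0, hC⟩ := ih
    refine ⟨‖c‖ * C, by positivity, fun a h => ?_⟩
    rw [Term.eval, norm_smul]
    exact mul_le_mul_of_nonneg_left (hC a h) (norm_nonneg _)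
  | add s t ihs iht =>
    obtain ⟨C, h0, hC⟩ := ihs
    obtain ⟨D, h1, hD⟩ := iht
    exact ⟨C + D, by positivity, fun a h =>
      (norm_add_le _ _).trans (add_le_add (hC a h) (hD a h))⟩
  | mul s t ihs iht =>
    obtain ⟨C, h0, hC⟩ := ihs
    obtain ⟨D, h1, hD⟩ := iht
    exact ⟨C * D, by positivity, fun a h =>
      (norm_mul_le _ _).trans (mul_le_mul (hC a h) (hD a h) (norm_nonneg _) h0)⟩
  | star t ih =>
    obtain ⟨C, h0, hC⟩ := ih
    exact ⟨C, h0, fun a h => by rw [Term.eval, norm_star]; exact hC a h⟩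

/-- Formulas are bounded on bounded sets of tuples, so that the quantifiers make sense. -/
theorem Formula.exists_abs_eval_le (A : Type u) [CStarAlgebra A] {n : ℕ} (φ : Formula n)
    (R : ℕ) : ∃ C : ℝ, ∀ a : Fin n → A, (∀ i, ‖a i‖ ≤ R) → |φ.eval a| ≤ C := by
  induction φ generalizing R with
  | norm t =>
    obtain ⟨C, -, hC⟩ := t.exists_norm_eval_le A R
    exact ⟨C, fun a h => by rw [Formula.eval, abs_of_nonneg (norm_nonneg _)]; exact hC a h⟩
  | conn g φ ih =>
    choose C hC using fun i => ih i R
    obtain ⟨D, hD⟩ := (isCompact_univ_pi fun i => isCompact_Icc (a := -C i) (b := C i)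
      ).exists_bound_of_continuousOn (f := g) g.continuous.continuousOn
    refine ⟨D, fun a h => ?_⟩
    rw [Formula.eval, ← Real.norm_eq_abs]
    exact hD _ fun i _ => abs_le.mp (hC i a h)
  | sup S φ ih =>
    obtain ⟨C, hC⟩ := ih (max R S)
    refine ⟨C, fun a h => ?_⟩
    have : Nonempty (Metric.closedBall (0 : A) (S : ℝ)) := ⟨⟨0, by simp⟩⟩
    have key : ∀ x : Metric.closedBall (0 : A) (S : ℝ),
        |φ.eval (Fin.snoc (α := fun _ => A) a x.1)| ≤ C := fun x => hC _ fun i => by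
      refine Fin.lastCases ?_ (fun j => ?_) i
      · have := mem_closedBall_zero_iff.mp x.2
        simp [this]
      · simp [h j]
    rw [Formula.eval, abs_le]
    exact ⟨(abs_le.mp (key ⟨0, by simp⟩)).1.trans
      (le_ciSup ⟨C, by rintro _ ⟨x, rfl⟩; exact (abs_le.mp (key x)).2⟩ _),
      ciSup_le fun x => (abs_le.mp (key x)).2⟩
  | inf S φ ih =>
    obtain ⟨C, hC⟩ := ih (max R S)
    refine ⟨C, fun a h => ?_⟩
    have : Nonempty (Metric.closedBall (0 : A) (S : ℝ)) := ⟨⟨0, by simp⟩⟩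
    have key : ∀ x : Metric.closedBall (0 : A) (S : ℝ),
        |φ.eval (Fin.snoc (α := fun _ => A) a x.1)| ≤ C := fun x => hC _ fun i => by
      refine Fin.lastCases ?_ (fun j => ?_) i
      · have := mem_closedBall_zero_iff.mp x.2
        simp [this]
      · simp [h j]
    rw [Formula.eval, abs_le]
    exact ⟨le_ciInf fun x => (abs_le.mp (key x)).1,
      (ciInf_le ⟨-C, by rintro _ ⟨x, rfl⟩; exact (abs_le.mp (key x)).1⟩ ⟨0, by simp⟩).trans
        (abs_le.mp (key _)).2⟩

/-- Formulas without quantifiers. -/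
def Formula.IsQuantifierFree : {n : ℕ} → Formula n → Prop
  | _, .norm _ => True
  | _, .conn _ φ => ∀ i, (φ i).IsQuantifierFree
  | _, .sup _ _ => False
  | _, .inf _ _ => False

/-- A theory is a set of sentences `φ`, each standing for the condition `φ = 0`. -/
abbrev Theory : Type := Set (Formula 0)

/-- `A` is a model of `T`. -/
def Models (A : Type u) [CStarAlgebra A] (T : Theory) : Prop :=
  ∀ φ ∈ T, φ.eval (Fin.elim0 : Fin 0 → A) = 0

/-- Embeddings of structures: isometric unital ⋆-homomorphisms. -/
def IsEmbedding {A : Type u} {B : Type v} [CStarAlgebra A] [CStarAlgebra B]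
    (f : A →⋆ₐ[ℂ] B) : Prop :=
  Isometry f

/-- Elementary maps: those that preserve the values of all formulas. -/
def IsElementary {A : Type u} {B : Type v} [CStarAlgebra A] [CStarAlgebra B]
    (f : A →⋆ₐ[ℂ] B) : Prop :=
  ∀ (n : ℕ) (φ : Formula n) (a : Fin n → A), φ.eval (fun i => f (a i)) = φ.eval a

/-- `T` is model complete: every embedding between models of `T` is elementary. -/
def Theory.IsModelComplete (T : Theory) : Prop :=
  ∀ (A B : Type u) [CStarAlgebra A] [CStarAlgebra B], Models A T → Models B T →
    ∀ f : A →⋆ₐ[ℂ] B, IsEmbedding f → IsElementary f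

/-- `T` has quantifier elimination: on tuples from any given domain of quantification, every
formula is, uniformly over all models of `T`, a uniform limit of quantifier-free formulas. -/
def Theory.HasQuantifierElimination (T : Theory) : Prop :=
  ∀ (n : ℕ) (φ : Formula n) (R : ℕ) (ε : ℝ), 0 < ε →
    ∃ ψ : Formula n, ψ.IsQuantifierFree ∧
      ∀ (A : Type u) [CStarAlgebra A], Models A T →
        ∀ a : Fin n → A, (∀ i, ‖a i‖ ≤ R) → |φ.eval a - ψ.eval a| ≤ ε

/-- Every model of `S` embeds into a model of `T`. -/
def Theory.EmbedsInto (S T : Theory) : Prop :=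
  ∀ (A : Type u) [CStarAlgebra A], Models A S →
    ∃ (B : Type u) (_ : CStarAlgebra B), Models B T ∧ ∃ f : A →⋆ₐ[ℂ] B, IsEmbedding f

/-- `T'` is a model companion of `T`. -/
structure Theory.IsModelCompanion (T' T : Theory) : Prop where
  isModelComplete : Theory.IsModelComplete.{u} T'
  embedsInto : Theory.EmbedsInto.{u} T T'
  embedsInto' : Theory.EmbedsInto.{u} T' T

/-- `T'` is a model completion of `T`: a model companion with quantifier elimination. -/
structure Theory.IsModelCompletion (T' T : Theory) : Prop where
  isModelCompanion : Theory.IsModelCompanion.{u} T' T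
  hasQuantifierElimination : Theory.HasQuantifierElimination.{u} T'

/-- The theory of connected abelian C⋆-algebras: all sentences `φ` such that `φ = 0` holds in
every abelian unital C⋆-algebra whose Gelfand spectrum is connected (and nonempty). -/
def Tconn : Theory :=
  {φ | ∀ (A : Type u) [CommCStarAlgebra A], ConnectedSpace (WeakDual.characterSpace ℂ A) →
    φ.eval (Fin.elim0 : Fin 0 → A) = 0}

end CStarLogic

namespace CStarLogic

/-! ### Homomorphisms and the values of formulas -/

/-! Both halves rest on one fact about a connected space `W`: if `r` maps `W` onto `[0,1]` and `s`
maps it into `[0,1]`, then `r - s` is nonpositive where `r = 0` and nonnegative where `r = 1`, so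
`r` and `s` agree somewhere. There `exp (2πi r) = -exp (2πi s)` is impossible, so `wrap` and
`antiWrap` cannot be co-amalgamated.

For the model completion, let `u = exp (2πi t)` in `C[0,1]`. Both `u` and `-u` have the whole circle
as range, so they satisfy the same quantifier-free conditions (`norm_eval_neg_wrapFun`). Only `u`
has an evident logarithm with spectrum in `[0,1]`, and quantifier elimination in a model `B` of `T'`
containing `C[0,1]` forces an approximate one on `-u` too (`logFormula`). Two such logarithms
contradict the fact above. Since `B` is only known to embed into a model of `Tconn`, which need not
be given as some `C(W)`, that fact is recast, with error bounds, as a sentence of `Tconn`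
(`sup_sup_gapFormula_mem_Tconn`). -/

theorem Term.eval_map {A : Type u} {B : Type v} [CStarAlgebra A] [CStarAlgebra B]
    (f : A →⋆ₐ[ℂ] B) {n : ℕ} (t : Term n) (a : Fin n → A) :
    t.eval (fun i => f (a i)) = f (t.eval a) := by
  induction t with
  | var i => rfl
  | one => simp [Term.eval]
  | smul c t ih => simp [Term.eval, ih]
  | add s t ihs iht => simp [Term.eval, ihs, iht]
  | mul s t ihs iht => simp [Term.eval, ihs, iht]
  | star t ih => simp [Term.eval, ih, map_star]

/-- The value of a quantifier-free formula depends only on the norms of the values of terms. -/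
theorem Formula.IsQuantifierFree.eval_congr {A : Type u} {B : Type v} [CStarAlgebra A]
    [CStarAlgebra B] {n : ℕ} {φ : Formula n} (hφ : φ.IsQuantifierFree) {a : Fin n → A}
    {b : Fin n → B} (h : ∀ t : Term n, ‖t.eval a‖ = ‖t.eval b‖) : φ.eval a = φ.eval b := by
  induction φ with
  | norm t => exact h t
  | conn g φ ih =>
    simp only [Formula.eval]
    exact congrArg g (funext fun i => ih i (hφ i) h)
  | sup R φ => exact hφ.elim
  | inf R φ => exact hφ.elim

/-- Embeddings preserve the values of quantifier-free formulas. -/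
theorem Formula.IsQuantifierFree.eval_map {A : Type u} {B : Type v} [CStarAlgebra A]
    [CStarAlgebra B] {n : ℕ} {φ : Formula n} (hφ : φ.IsQuantifierFree) {f : A →⋆ₐ[ℂ] B}
    (hf : IsEmbedding f) (a : Fin n → A) : φ.eval (fun i => f (a i)) = φ.eval a :=
  hφ.eval_congr fun t => by
    rw [t.eval_map f, AddMonoidHomClass.isometry_iff_norm f |>.mp hf]

theorem Formula.eval_snoc_le_sup {A : Type u} [CStarAlgebra A] {n : ℕ} (φ : Formula (n + 1))
    (R : ℕ) (a : Fin n → A) {x : A} (hx : ‖x‖ ≤ R) :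
    φ.eval (Fin.snoc (α := fun _ => A) a x) ≤ (Formula.sup R φ).eval a := by
  obtain ⟨S, hS⟩ : ∃ S : ℕ, ∀ i, ‖a i‖ ≤ S := by
    obtain ⟨C, hC⟩ := (Set.finite_range fun i => ‖a i‖).bddAbove
    obtain ⟨S, hS⟩ := exists_nat_ge C
    exact ⟨S, fun i => (hC ⟨i, rfl⟩).trans hS⟩
  -- The ball of radius `max R S` contains both the parameters and the quantified element, so the
  -- supremum is over a bounded set.
  obtain ⟨C, hC⟩ := φ.exists_abs_eval_le A (max R S)
  rw [Formula.eval]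
  refine le_ciSup (f := fun y : Metric.closedBall (0 : A) (R : ℝ) =>
    φ.eval (Fin.snoc (α := fun _ => A) a y.1)) ⟨C, ?_⟩ ⟨x, by simpa using hx⟩
  rintro _ ⟨y, rfl⟩
  refine (abs_le.mp (hC _ fun i => ?_)).2
  refine Fin.lastCases ?_ (fun j => ?_) i
  · have := mem_closedBall_zero_iff.mp y.2
    simp [this]
  · simp [hS j]

theorem Formula.inf_le_eval_snoc {A : Type u} [CStarAlgebra A] {n : ℕ} (φ : Formula (n + 1))
    (R : ℕ) (a : Fin n → A) {x : A} (hx : ‖x‖ ≤ R) :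
    (Formula.inf R φ).eval a ≤ φ.eval (Fin.snoc (α := fun _ => A) a x) := by
  obtain ⟨S, hS⟩ : ∃ S : ℕ, ∀ i, ‖a i‖ ≤ S := by
    obtain ⟨C, hC⟩ := (Set.finite_range fun i => ‖a i‖).bddAbove
    obtain ⟨S, hS⟩ := exists_nat_ge C
    exact ⟨S, fun i => (hC ⟨i, rfl⟩).trans hS⟩
  obtain ⟨C, hC⟩ := φ.exists_abs_eval_le A (max R S)
  rw [Formula.eval]
  refine ciInf_le (f := fun y : Metric.closedBall (0 : A) (R : ℝ) =>
    φ.eval (Fin.snoc (α := fun _ => A) a y.1)) ⟨-C, ?_⟩ ⟨x, by simpa using hx⟩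
  rintro _ ⟨y, rfl⟩
  refine (abs_le.mp (hC _ fun i => ?_)).1
  refine Fin.lastCases ?_ (fun j => ?_) i
  · have := mem_closedBall_zero_iff.mp y.2
    simp [this]
  · simp [hS j]

theorem Formula.exists_eval_snoc_lt_of_inf_lt {A : Type u} [CStarAlgebra A] {n : ℕ}
    (φ : Formula (n + 1)) (R : ℕ) (a : Fin n → A) {c : ℝ} (h : (Formula.inf R φ).eval a < c) :
    ∃ x : A, ‖x‖ ≤ R ∧ φ.eval (Fin.snoc (α := fun _ => A) a x) < c := by
  have : Nonempty (Metric.closedBall (0 : A) (R : ℝ)) := ⟨⟨0, by simp⟩⟩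
  rw [Formula.eval] at h
  obtain ⟨x, hx⟩ := exists_lt_of_ciInf_lt h
  exact ⟨x, mem_closedBall_zero_iff.mp x.2, hx⟩

theorem Formula.sup_eval_eq_zero {A : Type u} [CStarAlgebra A] {n : ℕ}
    (φ : Formula (n + 1)) (R : ℕ) (a : Fin n → A)
    (h : ∀ x : A, ‖x‖ ≤ R → φ.eval (Fin.snoc (α := fun _ => A) a x) = 0) :
    (Formula.sup R φ).eval a = 0 := by
  have : Nonempty (Metric.closedBall (0 : A) (R : ℝ)) := ⟨⟨0, by simp⟩⟩
  rw [Formula.eval]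
  exact (congrArg _ (funext fun x : Metric.closedBall (0 : A) (R : ℝ) =>
    h x.1 (mem_closedBall_zero_iff.mp x.2))).trans ciSup_const

/-! ### Taylor polynomials of `exp (2πi ·)` as terms -/

/-- Powers of a term. -/
def Term.pow {n : ℕ} (t : Term n) : ℕ → Term n
  | 0 => .one
  | k + 1 => .mul (t.pow k) t

/-- The Taylor polynomial `∑_{k < N} (2πi)ᵏ tᵏ / k!` of `exp (2πi t)`. -/
noncomputable def Term.expPoly {n : ℕ} (t : Term n) : ℕ → Term n
  -- Terms have no zero constant, so the empty sum is written `0 • 1`.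
  | 0 => .smul 0 .one
  | k + 1 => .add (t.expPoly k) (.smul ((2 * Real.pi * Complex.I) ^ k / k.factorial) (t.pow k))

/-- The positive element `x⋆ x`. -/
def Term.sq {n : ℕ} (t : Term n) : Term n := .mul (.star t) t

theorem Term.eval_pow {A : Type u} [CStarAlgebra A] {n : ℕ} (t : Term n) (k : ℕ) (a : Fin n → A) :
    (t.pow k).eval a = t.eval a ^ k := by
  induction k with
  | zero => simp [Term.pow, Term.eval]
  | succ k ih => rw [Term.pow, Term.eval, ih, pow_succ]

theorem Term.eval_expPoly {n : ℕ} (t : Term n) (N : ℕ) (a : Fin n → ℂ) :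
    (t.expPoly N).eval a =
      ∑ k ∈ Finset.range N, (2 * Real.pi * Complex.I * t.eval a) ^ k / k.factorial := by
  induction N with
  | zero => simp [Term.expPoly, Term.eval]
  | succ N ih =>
    rw [Term.expPoly, Term.eval, ih, Finset.sum_range_succ, Term.eval, Term.eval_pow, smul_eq_mul,
      mul_pow _ (t.eval a)]
    ring

theorem Term.eval_sq {n : ℕ} (t : Term n) (a : Fin n → ℂ) :
    t.sq.eval a = ((‖t.eval a‖ ^ 2 : ℝ) : ℂ) := by
  rw [Term.sq, Term.eval, Term.eval, Complex.star_def, Complex.conj_mul']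
  simp

/-- The value of `P(xⱼ⋆ xⱼ)` depends only on the value of `xⱼ`. -/
theorem Term.eval_sq_expPoly_congr {A : Type u} [CStarAlgebra A] {m n : ℕ} {j : Fin m} {k : Fin n}
    (N : ℕ) {a : Fin m → A} {b : Fin n → A} (h : a j = b k) :
    ((Term.var j).sq.expPoly N).eval a = ((Term.var k).sq.expPoly N).eval b := by
  induction N with
  | zero => rfl
  | succ N ih => simp only [Term.expPoly, Term.eval, Term.eval_pow, Term.sq, h] at ih ⊢; rw [ih]

theorem Term.eval_apply {X : Type u} [TopologicalSpace X] [CompactSpace X] {n : ℕ} (t : Term n)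
    (a : Fin n → C(X, ℂ)) (x : X) : t.eval a x = t.eval (fun i => a i x) :=
  (t.eval_map (ContinuousMap.evalStarAlgHom ℂ ℂ x) a).symm

theorem exists_forall_norm_expPoly_sub_exp_le {ε : ℝ} (hε : 0 < ε) :
    ∃ N : ℕ, ∀ (n : ℕ) (t : Term n) (a : Fin n → ℂ) (s : ℝ), 0 ≤ s → s ≤ 1 → t.eval a = s →
      ‖(t.expPoly N).eval a - Complex.exp (2 * Real.pi * s * Complex.I)‖ ≤ ε := by
  -- `Complex.exp_bound'` bounds the remainder by `‖z‖ ^ N / N! * 2` once `‖z‖ / (N + 1) ≤ 1 / 2`;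
  -- as `‖z‖ ≤ 2π`, taking `N ≥ 4π` is enough.
  have hlim := (FloorSemiring.tendsto_pow_div_factorial_atTop (2 * Real.pi)).mul_const 2
  rw [zero_mul] at hlim
  obtain ⟨N, hN, hN'⟩ := ((hlim.eventually_le_const hε).and
    (Filter.eventually_ge_atTop ⌈4 * Real.pi⌉₊)).exists
  refine ⟨N, fun n t a s h0 h1 hs => ?_⟩
  have hpi := Real.pi_pos
  set z : ℂ := 2 * Real.pi * Complex.I * s with hz
  have hzn : ‖z‖ ≤ 2 * Real.pi := by
    simp only [hz, norm_mul, Complex.norm_I, Complex.norm_real, Real.norm_eq_abs, abs_of_pos hpi,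
      abs_of_nonneg h0, Complex.norm_ofNat]
    nlinarith
  have hb : ‖z‖ / (N.succ : ℝ) ≤ 1 / 2 := by
    have := (Nat.le_ceil (4 * Real.pi)).trans (Nat.cast_le.mpr hN')
    rw [div_le_iff₀ (by positivity), Nat.cast_succ]
    linarith
  rw [Term.eval_expPoly, hs, ← hz, norm_sub_rev,
    show 2 * (Real.pi : ℂ) * s * Complex.I = z by rw [hz]; ring]
  refine (Complex.exp_bound' hb).trans (le_trans ?_ hN)
  gcongr

/-! ### A sentence true in connected algebras -/

/-- Approximate intermediate value theorem: either `d` changes sign between `p` and `q`, or one of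
these points already works. -/
theorem exists_abs_le_of_connected {W : Type*} [TopologicalSpace W] [ConnectedSpace W]
    {d : W → ℝ} (hd : Continuous d) {p q : W} {α β : ℝ} (hα : 0 ≤ α) (hβ : 0 ≤ β)
    (hp : -α ≤ d p) (hq : d q ≤ β) : ∃ w, |d w| ≤ α + β := by
  rcases le_total (d p) 0 with h | h
  · exact ⟨p, by rw [abs_of_nonpos h]; linarith⟩
  rcases le_total 0 (d q) with h' | h'
  · exact ⟨q, by rw [abs_of_nonneg h']; linarith⟩
  obtain ⟨w, hw⟩ := mem_range_of_exists_le_of_exists_ge hd ⟨q, h'⟩ ⟨p, h⟩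
  exact ⟨w, by rw [hw, abs_zero]; positivity⟩

theorem exists_norm_apply_eq_norm {W : Type*} [TopologicalSpace W] [CompactSpace W] [Nonempty W]
    (f : C(W, ℂ)) : ∃ w, ‖f w‖ = ‖f‖ := by
  obtain ⟨w, -, hw⟩ := isCompact_univ.exists_isMaxOn Set.univ_nonempty
    (f.continuous.norm.continuousOn)
  exact ⟨w, le_antisymm (f.norm_coe_le_norm w)
    ((f.norm_le (norm_nonneg _)).mpr fun x => hw (Set.mem_univ x))⟩

theorem norm_exp_sub_exp_le (a b : ℝ) :
    ‖Complex.exp (a * Complex.I) - Complex.exp (b * Complex.I)‖ ≤ |a - b| := by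
  have h : Complex.exp (a * Complex.I) - Complex.exp (b * Complex.I) =
      Complex.exp (b * Complex.I) * (Complex.exp (Complex.I * ((a - b : ℝ) : ℂ)) - 1) := by
    rw [mul_sub, ← Complex.exp_add, mul_one]
    congr 2
    push_cast
    ring
  rw [h, norm_mul, Complex.norm_exp_ofReal_mul_I, one_mul]
  exact Real.norm_exp_I_mul_ofReal_sub_one_le

/-- Twice a unit vector is the sum minus the difference, and the difference is at most `|a - b|`. -/
theorem two_sub_le_norm_exp_add_exp (a b : ℝ) :
    2 - |a - b| ≤ ‖Complex.exp (a * Complex.I) + Complex.exp (b * Complex.I)‖ := by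
  have h : (2 : ℂ) * Complex.exp (b * Complex.I) =
      (Complex.exp (a * Complex.I) + Complex.exp (b * Complex.I)) -
      (Complex.exp (a * Complex.I) - Complex.exp (b * Complex.I)) := by ring
  have h2 : ‖(2 : ℂ) * Complex.exp (b * Complex.I)‖ = 2 := by
    rw [norm_mul, Complex.norm_exp_ofReal_mul_I]
    simp
  have := norm_sub_le (Complex.exp (a * Complex.I) + Complex.exp (b * Complex.I))
    (Complex.exp (a * Complex.I) - Complex.exp (b * Complex.I))
  rw [← h, h2] at this
  linarith [norm_exp_sub_exp_le a b]

/-- The connective `(r, s, t) ↦ max 0 (1 - t - 8 (1 - r) - 8 (1 - s))`. -/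
def gapConnective : C(Fin 3 → ℝ, ℝ) where
  toFun v := max 0 (1 - v 2 - 8 * (1 - v 0) - 8 * (1 - v 1))
  continuous_toFun := by fun_prop

/-- With `h = x₀⋆ x₀`, `k = x₁⋆ x₁` and `P` the `N`-th Taylor polynomial of `exp (2πi ·)`, this says
that `‖P(h) + P(k)‖` is not small if the spectrum of `h` is close to containing `0` and `1`. -/
noncomputable def gapFormula (N : ℕ) : Formula 2 :=
  .conn gapConnective ![.norm (Term.var 0).sq,
    .norm (.add .one (.smul (-1) (Term.var 0).sq)),
    .norm (.add ((Term.var 0).sq.expPoly N) ((Term.var 1).sq.expPoly N))]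

theorem gapFormula_isQuantifierFree (N : ℕ) : (gapFormula N).IsQuantifierFree := by
  intro i
  fin_cases i <;> trivial

theorem gapFormula_eval {A : Type u} [CStarAlgebra A] (N : ℕ) (a : Fin 2 → A) :
    (gapFormula N).eval a = max 0 (1 - ‖((Term.var 0).sq.expPoly N).eval a +
      ((Term.var 1).sq.expPoly N).eval a‖ - 8 * (1 - ‖star (a 0) * a 0‖) -
      8 * (1 - ‖1 - star (a 0) * a 0‖)) := by
  simp [gapFormula, Formula.eval, gapConnective, Term.eval, Term.sq, sub_eq_add_neg]

theorem gapFormula_eval_continuousMap {N : ℕ}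
    (hN : ∀ (n : ℕ) (t : Term n) (a : Fin n → ℂ) (s : ℝ), 0 ≤ s → s ≤ 1 → t.eval a = s →
      ‖(t.expPoly N).eval a - Complex.exp (2 * Real.pi * s * Complex.I)‖ ≤ 1 / 8)
    {W : Type u} [TopologicalSpace W] [CompactSpace W] [ConnectedSpace W]
    (a : Fin 2 → C(W, ℂ)) (ha : ∀ i, ‖a i‖ ≤ 1) : (gapFormula N).eval a = 0 := by
  rw [gapFormula_eval, max_eq_left_iff]
  have hle (i : Fin 2) (w : W) : ‖a i w‖ ^ 2 ≤ 1 :=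
    pow_le_one₀ (norm_nonneg _) (((a i).norm_coe_le_norm w).trans (ha i))
  have hval (w : W) : (star (a 0) * a 0) w = ((‖a 0 w‖ ^ 2 : ℝ) : ℂ) := by
    simpa [Term.eval] using! (Term.var 0).eval_sq (fun i => a i w)
  -- The function `h = |a 0|²` is largest at `q` and smallest at `p`, so `1 - h q` and `h p` are the
  -- two penalties in the formula.
  obtain ⟨q, hq⟩ := exists_norm_apply_eq_norm (star (a 0) * a 0)
  obtain ⟨p, hp⟩ := exists_norm_apply_eq_norm (1 - star (a 0) * a 0)
  rw [hval, Complex.norm_real, Real.norm_of_nonneg (by positivity)] at hq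
  rw [ContinuousMap.sub_apply, hval, ContinuousMap.one_apply, ← Complex.ofReal_one,
    ← Complex.ofReal_sub, Complex.norm_real,
    Real.norm_of_nonneg (by linarith [hle 0 p])] at hp
  rw [← hq, ← hp]
  obtain ⟨w, hw⟩ := exists_abs_le_of_connected
    (d := fun w => ‖a 1 w‖ ^ 2 - ‖a 0 w‖ ^ 2) (by fun_prop) (p := p) (q := q)
    (α := ‖a 0 p‖ ^ 2) (β := 1 - ‖a 0 q‖ ^ 2) (by positivity) (by linarith [hle 0 q])
    (by linarith [sq_nonneg ‖a 1 p‖]) (by linarith [hle 1 q])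
  have key := ContinuousMap.norm_coe_le_norm (((Term.var 0).sq.expPoly N).eval a +
      ((Term.var 1).sq.expPoly N).eval a) w
  rw [ContinuousMap.add_apply, Term.eval_apply, Term.eval_apply] at key
  have h (i : Fin 2) := hN 2 (Term.var i).sq (fun j => a j w) _ (sq_nonneg _) (hle i w)
    (Term.eval_sq _ _)
  have h0 := h 0
  have h1 := h 1
  have h2 := two_sub_le_norm_exp_add_exp (2 * Real.pi * ‖a 1 w‖ ^ 2) (2 * Real.pi * ‖a 0 w‖ ^ 2)
  rw [← mul_sub, abs_mul, abs_of_pos Real.two_pi_pos] at h2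
  push_cast at h0 h1 h2
  set P := ((Term.var 0).sq.expPoly N).eval fun j => a j w
  set Q := ((Term.var 1).sq.expPoly N).eval fun j => a j w
  set e := Complex.exp (2 * Real.pi * (‖a 0 w‖ : ℂ) ^ 2 * Complex.I)
  set e' := Complex.exp (2 * Real.pi * (‖a 1 w‖ : ℂ) ^ 2 * Complex.I)
  have h3 : ‖e' + e‖ ≤ ‖P + Q‖ + (‖P - e‖ + ‖Q - e'‖) := by
    calc ‖e' + e‖ = ‖(P + Q) - ((P - e) + (Q - e'))‖ := by congr 1; ring
      _ ≤ _ := (norm_sub_le _ _).trans (by gcongr; exact norm_add_le _ _)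
  -- The weight `8` in the connective exceeds `2π`. The two Taylor errors cost `1 / 4` of the
  -- constant `2`, which leaves more than the required `1`.
  have h4 : 2 * Real.pi * |‖a 1 w‖ ^ 2 - ‖a 0 w‖ ^ 2| ≤
      8 * (‖a 0 p‖ ^ 2 + (1 - ‖a 0 q‖ ^ 2)) :=
    mul_le_mul (by linarith [Real.pi_lt_four]) hw (abs_nonneg _) (by norm_num)
  linarith

theorem sup_sup_gapFormula_mem_Tconn {N : ℕ}
    (hN : ∀ (n : ℕ) (t : Term n) (a : Fin n → ℂ) (s : ℝ), 0 ≤ s → s ≤ 1 → t.eval a = s →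
      ‖(t.expPoly N).eval a - Complex.exp (2 * Real.pi * s * Complex.I)‖ ≤ 1 / 8) :
    Formula.sup 1 (.sup 1 (gapFormula N)) ∈ Tconn.{u} := by
  intro A _ _
  refine Formula.sup_eval_eq_zero _ _ _ fun x hx =>
    Formula.sup_eval_eq_zero _ _ _ fun y hy => ?_
  -- The Gelfand transform reduces the claim to `C(W, ℂ)` with `W` connected.
  let G : A →⋆ₐ[ℂ] C(WeakDual.characterSpace ℂ A, ℂ) := gelfandStarTransform A
  have hG : IsEmbedding G := gelfandTransform_isometry A
  rw [← (gapFormula_isQuantifierFree N).eval_map hG]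
  refine gapFormula_eval_continuousMap hN _ fun i => ?_
  rw [(AddMonoidHomClass.isometry_iff_norm G).mp hG]
  refine Fin.lastCases ?_ (fun j => ?_) i
  · rw [Fin.snoc_last]
    simpa using hy
  · obtain rfl : j = Fin.last 0 := Subsingleton.elim _ _
    rw [Fin.snoc_castSucc, Fin.snoc_last]
    simpa using hx

theorem gapFormula_eval_nonpos {N : ℕ}
    (hN : ∀ (n : ℕ) (t : Term n) (a : Fin n → ℂ) (s : ℝ), 0 ≤ s → s ≤ 1 → t.eval a = s →
      ‖(t.expPoly N).eval a - Complex.exp (2 * Real.pi * s * Complex.I)‖ ≤ 1 / 8)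
    {A : Type u} [CStarAlgebra A] (hA : Models A Tconn.{u}) {x y : A} (hx : ‖x‖ ≤ 1)
    (hy : ‖y‖ ≤ 1) : (gapFormula N).eval ![x, y] ≤ 0 := by
  have h := hA _ (sup_sup_gapFormula_mem_Tconn hN)
  rw [← h]
  have h1 := (Formula.sup 1 (gapFormula N)).eval_snoc_le_sup 1 Fin.elim0 (x := x) (by simpa using hx)
  have h2 := (gapFormula N).eval_snoc_le_sup 1 (Fin.snoc (α := fun _ => A) Fin.elim0 x) (x := y)
    (by simpa using hy)
  refine le_trans (le_of_eq ?_) (h2.trans h1)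
  congr 1
  ext i
  fin_cases i <;> rfl

/-! ### Two maps of the interval onto the circle -/

/-- The map `t ↦ exp (2πi t)` of the unit interval onto the circle. -/
noncomputable def wrap : C(unitInterval, Circle) where
  toFun t := Circle.exp (2 * Real.pi * t)
  continuous_toFun := by fun_prop

/-- The map `t ↦ -exp (2πi t)` of the unit interval onto the circle. -/
noncomputable def antiWrap : C(unitInterval, Circle) where
  toFun t := Circle.exp (2 * Real.pi * t - Real.pi)
  continuous_toFun := by fun_prop

/-- Here the phase runs over `[-π, π]`, which contains every value of `arg`; `wrap` then follows by
a rotation. -/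
theorem antiWrap_surjective : Function.Surjective antiWrap := by
  intro z
  have h1 := Complex.neg_pi_lt_arg (z : ℂ)
  have h2 := Complex.arg_le_pi (z : ℂ)
  have hpi := Real.pi_pos
  refine ⟨⟨(Complex.arg z + Real.pi) / (2 * Real.pi), div_nonneg (by linarith) (by positivity),
    (div_le_one (by positivity)).mpr (by linarith)⟩, ?_⟩
  have : 2 * Real.pi * ((Complex.arg z + Real.pi) / (2 * Real.pi)) - Real.pi = Complex.arg z := by
    field_simp
    ring
  exact (congrArg Circle.exp this).trans (Circle.exp_arg z)

theorem wrap_eq_mul_antiWrap (t : unitInterval) : wrap t = Circle.exp Real.pi * antiWrap t := by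
  change Circle.exp _ = Circle.exp _ * Circle.exp _
  rw [← Circle.exp_add]
  congr 1
  ring

theorem coe_antiWrap (t : unitInterval) : (antiWrap t : ℂ) = -(wrap t : ℂ) := by
  rw [wrap_eq_mul_antiWrap, Circle.coe_mul, Circle.coe_exp, Complex.exp_pi_mul_I]
  ring

theorem wrap_surjective : Function.Surjective wrap := by
  intro z
  obtain ⟨t, ht⟩ := antiWrap_surjective ((Circle.exp Real.pi)⁻¹ * z)
  exact ⟨t, by rw [wrap_eq_mul_antiWrap, ht, mul_inv_cancel_left]⟩

theorem wrap_antiWrap_not_coamalgamable {W : Type*} [TopologicalSpace W] [ConnectedSpace W]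
    {r s : C(W, unitInterval)} (hr : Function.Surjective r) :
    ¬ ∀ w, wrap (r w) = antiWrap (s w) := by
  intro h
  obtain ⟨p, hp⟩ := hr 0
  obtain ⟨q, hq⟩ := hr 1
  obtain ⟨w, hw⟩ := mem_range_of_exists_le_of_exists_ge
    (f := fun w => (r w : ℝ) - s w) (c := 0) (by fun_prop)
    ⟨p, by simp [hp, unitInterval.nonneg]⟩ ⟨q, by simp [hq, unitInterval.le_one]⟩
  have hrs : r w = s w := Subtype.ext (sub_eq_zero.mp hw)
  have h1 := congrArg (Circle.coeHom) (h w)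
  change (wrap (r w) : ℂ) = (antiWrap (s w) : ℂ) at h1
  rw [coe_antiWrap, hrs, eq_neg_iff_add_eq_zero, ← two_mul] at h1
  simp at h1

/-! ### The absence of a model completion -/

/-- The norm of a term is the supremum of its values over the joint range of the tuple, hence
monotone in that range. -/
theorem norm_eval_le_of_forall_exists {X : Type u} [TopologicalSpace X] [CompactSpace X] {n : ℕ}
    (t : Term n) {a b : Fin n → C(X, ℂ)} (h : ∀ x, ∃ y, ∀ i, a i x = b i y) :
    ‖t.eval a‖ ≤ ‖t.eval b‖ := by
  refine (ContinuousMap.norm_le _ (norm_nonneg _)).mpr fun x => ?_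
  obtain ⟨y, hy⟩ := h x
  rw [Term.eval_apply, funext hy, ← Term.eval_apply]
  exact ContinuousMap.norm_coe_le_norm _ _

/-- The function `t ↦ exp (2πi t)` on the unit interval. -/
noncomputable def wrapFun : C(ULift.{u} unitInterval, ℂ) where
  toFun t := wrap t.down
  continuous_toFun := continuous_subtype_val.comp (wrap.continuous.comp continuous_uliftDown)

/-- The function `t ↦ √t` on the unit interval. -/
noncomputable def sqrtFun : C(ULift.{u} unitInterval, ℂ) where
  toFun t := (Real.sqrt t.down : ℝ)
  continuous_toFun := Complex.continuous_ofReal.comp (Real.continuous_sqrt.comp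
    (continuous_subtype_val.comp continuous_uliftDown))

theorem norm_eval_neg_wrapFun (t : Term 1) :
    ‖t.eval ![-wrapFun.{u}]‖ = ‖t.eval ![wrapFun.{u}]‖ := by
  refine le_antisymm (norm_eval_le_of_forall_exists t fun x => ?_)
    (norm_eval_le_of_forall_exists t fun x => ?_)
  · obtain ⟨y, hy⟩ := wrap_surjective (antiWrap x.down)
    refine ⟨⟨y⟩, fun i => ?_⟩
    simp [wrapFun, hy, coe_antiWrap]
  · obtain ⟨y, hy⟩ := antiWrap_surjective (wrap x.down)
    refine ⟨⟨y⟩, fun i => ?_⟩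
    simp [wrapFun, ← hy, coe_antiWrap]

theorem norm_wrapFun_le : ‖wrapFun.{u}‖ ≤ 1 :=
  (ContinuousMap.norm_le _ zero_le_one).mpr fun t => (Circle.norm_coe (wrap t.down)).le

theorem norm_sqrtFun_le : ‖sqrtFun.{u}‖ ≤ 1 := by
  refine (ContinuousMap.norm_le _ zero_le_one).mpr fun t => ?_
  simp only [sqrtFun, ContinuousMap.coe_mk, Complex.norm_real,
    Real.norm_of_nonneg (Real.sqrt_nonneg _)]
  exact Real.sqrt_le_one.mpr t.down.2.2

theorem star_sqrtFun_mul_apply (t : ULift.{u} unitInterval) :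
    (star sqrtFun * sqrtFun) t = ((t.down : ℝ) : ℂ) := by
  simp only [sqrtFun, ContinuousMap.mul_apply, ContinuousMap.star_apply, ContinuousMap.coe_mk,
    Complex.star_def, Complex.conj_ofReal, ← Complex.ofReal_mul,
    Real.mul_self_sqrt t.down.2.1]

/-- With the next lemma, this makes both penalties in `gapFormula` vanish at `sqrtFun`: its square
`t` attains `1` and `0`. -/
theorem one_le_norm_sq_sqrtFun : 1 ≤ ‖star sqrtFun.{u} * sqrtFun‖ := by
  simpa [star_sqrtFun_mul_apply, -ContinuousMap.mul_apply, -ContinuousMap.coe_mul] using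
    (star sqrtFun.{u} * sqrtFun).norm_coe_le_norm ⟨1⟩

theorem one_le_norm_one_sub_sq_sqrtFun : 1 ≤ ‖1 - star sqrtFun.{u} * sqrtFun‖ := by
  have h := (1 - star sqrtFun.{u} * sqrtFun).norm_coe_le_norm ⟨0⟩
  rw [ContinuousMap.sub_apply, star_sqrtFun_mul_apply] at h
  simpa using h

/-- The formula `inf_{‖y‖ ≤ 1} ‖x - P(y⋆ y)‖`, with `P` the `N`-th Taylor polynomial
of `exp (2πi ·)`, which measures how far `x` is from having a logarithm with spectrum in `[0, 1]`. -/
noncomputable def logFormula (N : ℕ) : Formula 1 :=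
  .inf 1 (.norm (.add (.var 0) (.smul (-1) ((Term.var 1).sq.expPoly N))))

theorem norm_wrapFun_sub_le {N : ℕ}
    (hN : ∀ (n : ℕ) (t : Term n) (a : Fin n → ℂ) (s : ℝ), 0 ≤ s → s ≤ 1 → t.eval a = s →
      ‖(t.expPoly N).eval a - Complex.exp (2 * Real.pi * s * Complex.I)‖ ≤ 1 / 8)
    {n : ℕ} (j : Fin n) (a : Fin n → C(ULift.{u} unitInterval, ℂ)) (ha : a j = sqrtFun) :
    ‖wrapFun - ((Term.var j).sq.expPoly N).eval a‖ ≤ 1 / 8 := by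
  refine (ContinuousMap.norm_le _ (by norm_num)).mpr fun t => ?_
  rw [ContinuousMap.sub_apply, norm_sub_rev, Term.eval_apply]
  have h := hN n (Term.var j).sq (fun i => a i t) (t.down : ℝ) t.down.2.1 t.down.2.2 (by
    rw [← Term.eval_apply, ← star_sqrtFun_mul_apply, ← ha]
    rfl)
  have hw : wrapFun t = Complex.exp (2 * Real.pi * (t.down : ℝ) * Complex.I) :=
    (Circle.coe_exp _).trans (by push_cast; rfl)
  rwa [hw]

instance : ConnectedSpace (ULift.{u} unitInterval) :=
  Homeomorph.ulift.symm.surjective.connectedSpace Homeomorph.ulift.symm.continuous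

theorem models_Tconn_continuousMap : Models C(ULift.{u} unitInterval, ℂ) Tconn.{u} := fun _ hφ =>
  hφ _ ((WeakDual.CharacterSpace.homeoEval (ULift.{u} unitInterval) ℂ).surjective.connectedSpace
    (WeakDual.CharacterSpace.homeoEval (ULift.{u} unitInterval) ℂ).continuous)

theorem not_isModelCompletion_Tconn (T' : Theory) :
    ¬ Theory.IsModelCompletion.{u} T' Tconn.{u} := by
  intro hT
  obtain ⟨N, hN⟩ := exists_forall_norm_expPoly_sub_exp_le (ε := 1 / 8) (by norm_num)
  obtain ⟨ψ, hψ, hφψ⟩ := hT.hasQuantifierElimination 1 (logFormula N) 1 (1 / 8) (by norm_num)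
  obtain ⟨B, _, hB, f, hf⟩ := hT.isModelCompanion.embedsInto _ models_Tconn_continuousMap.{u}
  obtain ⟨C, _, hC, g, hg⟩ := hT.isModelCompanion.embedsInto' B hB
  have hfn := (AddMonoidHomClass.isometry_iff_norm f).mp hf
  have hgn := (AddMonoidHomClass.isometry_iff_norm g).mp hg
  have hw : ‖f wrapFun‖ ≤ 1 := (hfn _).trans_le norm_wrapFun_le
  have hψ_eq : ψ.eval ![-f wrapFun] = ψ.eval ![f wrapFun] := by
    have e1 := hψ.eval_map hf ![-wrapFun]
    have e2 := hψ.eval_map hf ![wrapFun]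
    rw [hψ.eval_congr norm_eval_neg_wrapFun, ← e2] at e1
    convert e1 using 2 <;> ext i <;> simp
  have h1 := abs_le.mp (hφψ B hB ![f wrapFun] (by simpa using hw))
  have h2 := abs_le.mp (hφψ B hB ![-f wrapFun] (by simpa using hw))
  have h3 : (logFormula N).eval ![f wrapFun] ≤ 1 / 8 := by
    refine (Formula.inf_le_eval_snoc _ 1 _ (x := f sqrtFun)
      (by simpa [hfn] using norm_sqrtFun_le)).trans ?_
    have : (Fin.snoc (α := fun _ => B) ![f wrapFun] (f sqrtFun)) =
        fun i => f (![wrapFun, sqrtFun] i) := by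
      ext i; fin_cases i <;> rfl
    -- Once the witness is chosen the formula is quantifier-free, so it can be evaluated in
    -- `C[0,1]`.
    rw [this, Formula.IsQuantifierFree.eval_map (by trivial) hf]
    simpa [Formula.eval, Term.eval, ← sub_eq_add_neg] using
      norm_wrapFun_sub_le hN 1 ![wrapFun, sqrtFun] rfl
  -- The bound is `3 / 8`: one `1 / 8` from `h3` and one from each use of `ψ` in place of
  -- `logFormula`.
  have h4 : (logFormula N).eval ![-f wrapFun] < 1 / 2 := by linarith [h1.1, h2.2]
  obtain ⟨y, hy, hlt⟩ := Formula.exists_eval_snoc_lt_of_inf_lt _ 1 _ h4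
  have hs : ‖f sqrtFun‖ ≤ 1 := (hfn _).trans_le norm_sqrtFun_le
  have h5 : (gapFormula N).eval ![f sqrtFun, y] ≤ 0 := by
    -- The sentence is available in `C`; its quantifier-free matrix pulls back along `g` to `B`.
    refine le_trans (le_of_eq ?_) (gapFormula_eval_nonpos hN hC (x := g (f sqrtFun)) (y := g y)
      ((hgn _).trans_le hs) ((hgn _).trans_le (by simpa using hy)))
    rw [← (gapFormula_isQuantifierFree N).eval_map hg]
    congr 1
    ext i
    fin_cases i <;> rfl
  rw [gapFormula_eval] at h5
  have h6 := (le_max_right _ _).trans h5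
  set P := ((Term.var 0).sq.expPoly N).eval ![f sqrtFun, y]
  set Q := ((Term.var 1).sq.expPoly N).eval ![f sqrtFun, y]
  have hP : ‖f wrapFun - P‖ ≤ 1 / 8 := by
    have hPf : P = f (((Term.var 0).sq.expPoly N).eval ![sqrtFun]) := by
      rw [← Term.eval_map]
      exact Term.eval_sq_expPoly_congr N rfl
    rw [hPf, ← map_sub, hfn]
    exact norm_wrapFun_sub_le hN 0 ![sqrtFun] rfl
  have hQ : ‖-f wrapFun - Q‖ < 1 / 2 := by
    have hQ' : Q = ((Term.var 1).sq.expPoly N).eval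
        (Fin.snoc (α := fun _ => B) ![-f wrapFun] y) := Term.eval_sq_expPoly_congr N rfl
    rw [hQ', sub_eq_add_neg, ← neg_one_smul ℂ (Term.eval _ _)]
    exact hlt
  -- The terms `f wrapFun` and `-f wrapFun` cancel, so `‖P + Q‖ < 1 / 8 + 1 / 2 < 1`, whereas `h6`
  -- to `h8` give at least `1`.
  have hPQ : ‖P + Q‖ ≤ ‖f wrapFun - P‖ + ‖-f wrapFun - Q‖ := by
    rw [← norm_neg (P + Q)]
    refine le_trans (le_of_eq (congrArg _ ?_)) (norm_add_le _ _)
    abel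
  have h7 : 1 ≤ ‖star (f sqrtFun) * f sqrtFun‖ := by
    rw [← map_star, ← map_mul, hfn]
    exact one_le_norm_sq_sqrtFun
  have h8 : 1 ≤ ‖1 - star (f sqrtFun) * f sqrtFun‖ := by
    rw [← map_star, ← map_mul, ← map_one f, ← map_sub, hfn]
    exact one_le_norm_one_sub_sq_sqrtFun
  change 1 - ‖P + Q‖ - 8 * (1 - ‖star (f sqrtFun) * f sqrtFun‖) -
    8 * (1 - ‖1 - star (f sqrtFun) * f sqrtFun‖) ≤ 0 at h6
  linarith

end CStarLogic

/-- The theory of connected abelian C⋆-algebras has no model completion; moreover, continua do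
not have the co-amalgamation property, already for two maps of the unit interval onto the circle. -/
theorem proposition3p2 :
    (¬ ∃ T' : CStarLogic.Theory,
      CStarLogic.Theory.IsModelCompletion.{u} T' CStarLogic.Tconn.{u}) ∧
    ∃ f g : C(unitInterval, Circle), Function.Surjective f ∧ Function.Surjective g ∧
      ¬ ∃ (W : Type u) (_ : TopologicalSpace W) (_ : CompactSpace W) (_ : T2Space W)
          (_ : ConnectedSpace W) (r s : C(W, unitInterval)),
        Function.Surjective r ∧ Function.Surjective s ∧ ∀ w, f (r w) = g (s w) := by
  refine ⟨fun ⟨T', hT⟩ => CStarLogic.not_isModelCompletion_Tconn T' hT, CStarLogic.wrap,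
    CStarLogic.antiWrap, CStarLogic.wrap_surjective, CStarLogic.antiWrap_surjective, ?_⟩
  rintro ⟨W, _, _, _, _, r, s, hr, -, h⟩
  exact CStarLogic.wrap_antiWrap_not_coamalgamable hr h
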